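/- Let $\Theta$ be a Polish metric space. A measure on $\Theta$ is called locally finite if it is finite on bounded sets; random measures are random elements of the space of measures that are almost surely locally finite. Let $\mathrm{BM}_+(\Theta)$ be the set of measurable, nonnegative, bounded functions on $\Theta$ with bounded support. For a locally finite measure $\mu$, $\mathrm{PP}(\mu)$ is the law of a Poisson random measure with mean measure $\mu$. For locally finite measures $H, M$ and $b,c>0$, a random measure $W$ has law $\mathrm{GaP}(H,b)$ if $$\mathrm E\, e^{-\int f\,dW}=\exp\Big(-\int_\Theta\log(1+f/b)\,dH\Big)\qquad\text{for all } f\in \mathrm{BM}_+(\Theta),$$ and law $\mathrm{NcGaP}(H,M,c^{-1})$ if $$\mathrm E\, e^{-\int f\,dW}=\exp\Big(-\int_\Theta\log(1+cf)\,dH-\int_\Theta\frac{cf}{1+cf}\,dM\Big)\qquad\text{for all } f\in \mathrm{BM}_+(\Theta).$$ Let $H$ be a locally finite measure on $\Theta$ and let $\beta_t>0$, $c_t>0$ for $t\ge 2$. Starting from a random measure $W_1$ on $\Theta$, let $(W_t,V_{t+1})_{t\ge1}$ be generated successively, for $t\ge 1$, by $$V_{t+1}\mid W_t\sim \mathrm{PP}(\beta_{t+1}W_t),\qquad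 W_{t+1}\mid V_{t+1}\sim \mathrm{GaP}(H+V_{t+1},c_{t+1}^{-1}),$$ where $V_{t+1}$ is conditionally independent of $(W_1,V_2,W_2,\dots,V_t,W_t)$ given $W_t$, and $W_{t+1}$ is conditionally independent of $(W_1,V_2,W_2,\dots,V_t,W_t)$ given $V_{t+1}$. Then for every $t\ge1$ $$W_{t+1}\mid W_t\sim \mathrm{NcGaP}\big(H,\beta_{t+1}W_t,c_{t+1}^{-1}\big).$$ Moreover, $(W_t)_{t\ge1}$ is an M-ARG(1) process, that is, a Markov process of locally finite random measures with these one-step conditional laws. -/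

import Mathlib

open MeasureTheory ProbabilityTheory
open scoped ENNReal NNReal

noncomputable section

namespace MARG

/-- A measure on a metric space is locally finite if it gives finite mass to every bounded set. -/
def LocFinite {Θ : Type*} [MetricSpace Θ] [MeasurableSpace Θ] (μ : Measure Θ) : Prop :=
  ∀ B : Set Θ, Bornology.IsBounded B → μ B < ∞

/-- The class `BM₊(Θ)`: measurable, nonnegative, bounded functions with bounded support. -/
structure IsBMPlus {Θ : Type*} [MetricSpace Θ] [MeasurableSpace Θ] (f : Θ → ℝ) : Prop where
  measurable : Measurable f
  nonneg : ∀ θ, 0 ≤ f θ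
  bounded : ∃ C : ℝ, ∀ θ, f θ ≤ C
  bounded_support : Bornology.IsBounded (Function.support f)

/-- `Q` is the law of a locally finite random measure on `Θ`. -/
structure IsRandomMeasureLaw {Θ : Type*} [MetricSpace Θ] [MeasurableSpace Θ]
    (Q : Measure (Measure Θ)) : Prop where
  isProbabilityMeasure : IsProbabilityMeasure Q
  locFinite : ∀ᵐ ν ∂Q, LocFinite ν

/-- The Laplace functional `f ↦ E exp(-∫ f dW)` of a random measure `W` with law `Q`. -/
def laplaceFunctional {Θ : Type*} [MeasurableSpace Θ] (Q : Measure (Measure Θ)) (f : Θ → ℝ) : ℝ :=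
  ∫ ν, Real.exp (-∫ θ, f θ ∂ν) ∂Q

/-- `Q = PP(μ)`: the law of a Poisson random measure with mean measure `μ`. The number of points
in a measurable set `A` of finite mean is Poisson with mean `μ A`, and the numbers of points in
pairwise disjoint measurable sets are independent. -/
structure IsPoissonLaw {Θ : Type*} [MetricSpace Θ] [MeasurableSpace Θ]
    (Q : Measure (Measure Θ)) (μ : Measure Θ) : Prop extends IsRandomMeasureLaw Q where
  poisson : ∀ A : Set Θ, MeasurableSet A → μ A < ∞ →
    Q.map (fun ν : Measure Θ => ν A) =
      (poissonMeasure (μ A).toNNReal).map (fun n : ℕ => (n : ℝ≥0∞))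
  indep : ∀ (n : ℕ) (A : Fin n → Set Θ), (∀ i, MeasurableSet (A i)) →
    Pairwise (fun i j => Disjoint (A i) (A j)) →
    iIndepFun (fun (i : Fin n) (ν : Measure Θ) => ν (A i)) Q

/-- `Q = GaP(H, b)`: the law of a gamma random measure with base measure `H` and rate `b`. -/
structure IsGammaLaw {Θ : Type*} [MetricSpace Θ] [MeasurableSpace Θ]
    (Q : Measure (Measure Θ)) (H : Measure Θ) (b : ℝ) : Prop extends IsRandomMeasureLaw Q where
  laplace : ∀ f : Θ → ℝ, IsBMPlus f →
    laplaceFunctional Q f = Real.exp (-∫ θ, Real.log (1 + f θ / b) ∂H)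

/-- `Q = NcGaP(H, M, b)`: the law of a noncentral gamma random measure with base measures `H`, `M`
and rate `b`; in terms of the scale `c`, `b = c⁻¹` and `f θ / b = c * f θ`. -/
structure IsNcGammaLaw {Θ : Type*} [MetricSpace Θ] [MeasurableSpace Θ]
    (Q : Measure (Measure Θ)) (H M : Measure Θ) (b : ℝ) : Prop extends IsRandomMeasureLaw Q where
  laplace : ∀ f : Θ → ℝ, IsBMPlus f →
    laplaceFunctional Q f =
      Real.exp (-(∫ θ, Real.log (1 + f θ / b) ∂H) - ∫ θ, (f θ / b) / (1 + f θ / b) ∂M)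

/-- `Y | X ∼ L(X)`: there is a regular conditional distribution `κ` of `Y` given `X` such that,
for almost every value `x` of `X`, the law `κ x` has the property `L x`. -/
def HasCondLaw {Ω E F : Type*} [MeasurableSpace Ω] [MeasurableSpace E] [MeasurableSpace F]
    (P : Measure Ω) (Y : Ω → F) (X : Ω → E) (L : E → Measure F → Prop) : Prop :=
  ∃ κ : Kernel E F, IsMarkovKernel κ ∧ HasCondDistrib Y X κ P ∧ ∀ᵐ x ∂(P.map X), L x (κ x)

/-- Given the σ-algebra `m` (the past, containing `σ(X)`), the conditional law of `Y` depends on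
`X` only. -/
def DependsOnPastThrough {Ω E F : Type*} [MeasurableSpace Ω] [mE : MeasurableSpace E]
    [MeasurableSpace F] (P : Measure Ω) (Y : Ω → F) (m : MeasurableSpace Ω) (X : Ω → E) : Prop :=
  ∀ A : Set F, MeasurableSet A → P⟦Y ⁻¹' A | m⟧ =ᵐ[P] P⟦Y ⁻¹' A | mE.comap X⟧

/-- `σ(Z_s : a ≤ s ≤ t)`. -/
abbrev sigmaRange {Ω E : Type*} [mE : MeasurableSpace E] (Z : ℕ → Ω → E) (a t : ℕ) :
    MeasurableSpace Ω :=
  ⨆ s ∈ Set.Icc a t, mE.comap (Z s)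

/-- The state-space construction `W₁, V₂, W₂, V₃, W₃, …`: starting from the locally finite random
measure `W₁`, each `V_{t+1}` is drawn from `PP(β_{t+1} W_t)` and each `W_{t+1}` is drawn from
`GaP(H + V_{t+1}, c_{t+1}⁻¹)`; each draw depends on the earlier variables only through the one it
is conditioned on. The values `W 0`, `V 0`, `V 1` are not used. -/
structure IsStateSpaceModel {Ω Θ : Type*} [MeasurableSpace Ω] [MetricSpace Θ] [MeasurableSpace Θ]
    (P : Measure Ω) (H : Measure Θ) (β c : ℕ → ℝ) (W V : ℕ → Ω → Measure Θ) : Prop where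
  measurable_W : ∀ t, 1 ≤ t → Measurable (W t)
  measurable_V : ∀ t, 2 ≤ t → Measurable (V t)
  init_locFinite : ∀ᵐ ω ∂P, LocFinite (W 1 ω)
  law_V : ∀ t, 1 ≤ t → HasCondLaw P (V (t + 1)) (W t)
    (fun M Q => IsPoissonLaw Q (ENNReal.ofReal (β (t + 1)) • M))
  markov_V : ∀ t, 1 ≤ t →
    DependsOnPastThrough P (V (t + 1)) (sigmaRange W 1 t ⊔ sigmaRange V 2 t) (W t)
  law_W : ∀ t, 1 ≤ t → HasCondLaw P (W (t + 1)) (V (t + 1))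
    (fun N Q => IsGammaLaw Q (H + N) (c (t + 1))⁻¹)
  markov_W : ∀ t, 1 ≤ t →
    DependsOnPastThrough P (W (t + 1)) (sigmaRange W 1 t ⊔ sigmaRange V 2 (t + 1)) (V (t + 1))

/-- `(W_t)_{t ≥ 1}` is a measure-valued autoregressive gamma process of order one, M-ARG(1), with
parameters `H`, `(β_t)_{t ≥ 2}`, `(c_t)_{t ≥ 2}`: a Markov process of locally finite random measures
with `W_{t+1} | W_t ∼ NcGaP(H, β_{t+1} W_t, c_{t+1}⁻¹)`. -/
structure IsMARG1 {Ω Θ : Type*} [MeasurableSpace Ω] [MetricSpace Θ] [MeasurableSpace Θ]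
    (P : Measure Ω) (H : Measure Θ) (β c : ℕ → ℝ) (W : ℕ → Ω → Measure Θ) : Prop where
  locFinite_H : LocFinite H
  pos_β : ∀ t, 2 ≤ t → 0 < β t
  pos_c : ∀ t, 2 ≤ t → 0 < c t
  measurable : ∀ t, 1 ≤ t → Measurable (W t)
  locFinite : ∀ t, 1 ≤ t → ∀ᵐ ω ∂P, LocFinite (W t ω)
  markov : ∀ t, 1 ≤ t → DependsOnPastThrough P (W (t + 1)) (sigmaRange W 1 t) (W t)
  transition : ∀ t, 1 ≤ t → HasCondLaw P (W (t + 1)) (W t)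
    (fun M Q => IsNcGammaLaw Q H (ENNReal.ofReal (β (t + 1)) • M) (c (t + 1))⁻¹)

end MARG

end

/-! Given `W_t = M` and `V_{t+1} = N`, the gamma Laplace functional is `exp(-∫ log(1+cf) dH) ·
exp(-∫ log(1+cf) dN)`. Averaging over the Poisson `N` leaves the first factor alone and turns the
second into the Poisson Laplace functional at `g = log(1+cf)`, namely `exp(-∫ (1 - e^{-g}) dβM)`.
Since `1 - e^{-g} = cf/(1+cf)`, this is the noncentral gamma functional
(`IsPoissonLaw.isNcGammaLaw_comp`). The Poisson functional itself is derived from independent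
Poisson counts: simple functions first, then dominated convergence.

For the conditioning, `HasKernelGiven` encodes "given `m`, `Y` has law `κ (X ·)`" as an identity of
measures on each event of `m`. In this form two successive draws compose by associativity of kernel
composition. Conditioning on the whole past then gives the Markov property and the transition law
from one kernel, `η ∘ₖ κ`. -/

namespace MARG

/-! ### Conditional laws through kernels. -/

section CondLaw

variable {Ω E F G : Type*} {m m' mΩ : MeasurableSpace Ω} {mE : MeasurableSpace E}
  {mF : MeasurableSpace F} {mG : MeasurableSpace G} {P : Measure Ω}

/-- Given the σ-algebra `m`, the conditional law of `Y` is `κ (X ·)`. The condition is expressed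
through the laws of `Y` on the events of `m`. -/
def HasKernelGiven (m : MeasurableSpace Ω) {mΩ : MeasurableSpace Ω} (P : Measure Ω)
    (Y : Ω → F) (X : Ω → E) (κ : Kernel E F) : Prop :=
  ∀ B, MeasurableSet[m] B → (P.restrict B).map Y = κ ∘ₘ ((P.restrict B).map X)

lemma HasKernelGiven.mono {Y : Ω → F} {X : Ω → E} {κ : Kernel E F}
    (h : HasKernelGiven m P Y X κ) (hm : m' ≤ m) : HasKernelGiven m' P Y X κ :=
  fun B hB => h B (hm B hB)

/-- Composition of two successive draws. -/
lemma HasKernelGiven.comp {Y : Ω → F} {Z : Ω → G} {X : Ω → E}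
    {κ : Kernel E F} {η : Kernel F G} (hY : HasKernelGiven m P Y X κ)
    (hZ : HasKernelGiven m' P Z Y η) (hm : m ≤ m') : HasKernelGiven m P Z X (η ∘ₖ κ) := by
  intro B hB
  rw [hZ B (hm B hB), hY B hB, Measure.comp_assoc]

lemma HasKernelGiven.measure_inter {Y : Ω → F} {X : Ω → E}
    {κ : Kernel E F} (h : HasKernelGiven m P Y X κ) (hX : Measurable X) (hY : Measurable Y)
    {B : Set Ω} (hB : MeasurableSet[m] B) {A : Set F} (hA : MeasurableSet A) :
    P (Y ⁻¹' A ∩ B) = ∫⁻ ω in B, κ (X ω) A ∂P := by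
  have := congrArg (fun ν => ν A) (h B hB)
  rwa [Measure.map_apply hY hA, Measure.restrict_apply (hY hA),
    Measure.bind_apply hA κ.aemeasurable, lintegral_map (κ.measurable_coe hA) hX] at this

/-- The events `X ⁻¹' s` lie in `m`, so the joint law is known on rectangles, and these determine a
finite measure. -/
lemma HasKernelGiven.hasCondDistrib [IsFiniteMeasure P] {Y : Ω → F}
    {X : Ω → E} {κ : Kernel E F} [IsMarkovKernel κ] (h : HasKernelGiven m P Y X κ)
    (hX : Measurable X) (hY : Measurable Y) (hXm : mE.comap X ≤ m) : HasCondDistrib Y X κ P := by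
  refine ⟨by exact (hX.prodMk hY).aemeasurable, ?_⟩
  refine Measure.ext_prod fun {s t} hs ht => ?_
  rw [Measure.map_apply (hX.prodMk hY) (hs.prod ht), Measure.compProd_apply_prod hs ht,
    setLIntegral_map hs (κ.measurable_coe ht) hX,
    ← h.measure_inter hX hY (hXm _ ⟨s, hs, rfl⟩) ht, Set.inter_comm]
  rfl

lemma integrable_kernel_real [IsFiniteMeasure P] {X : Ω → E} {κ : Kernel E F}
    [IsMarkovKernel κ] (hX : Measurable X) {A : Set F} (hA : MeasurableSet A) :
    Integrable (fun ω => (κ (X ω)).real A) P :=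
  Integrable.of_bound (((κ.measurable_coe hA).comp hX).ennreal_toReal.aestronglyMeasurable) 1
    (.of_forall fun ω => by
      rw [Real.norm_of_nonneg measureReal_nonneg]; exact measureReal_le_one)

/-- Because `σ(X) ≤ m`, the candidate is `m`-measurable; its integrals over events of `m` are those
prescribed by `measure_inter`. -/
lemma HasKernelGiven.condExp_ae_eq [IsFiniteMeasure P] {Y : Ω → F}
    {X : Ω → E} {κ : Kernel E F} [IsMarkovKernel κ] (h : HasKernelGiven m P Y X κ)
    (hX : Measurable X) (hY : Measurable Y) (hXm : mE.comap X ≤ m) (hm : m ≤ mΩ)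
    {A : Set F} (hA : MeasurableSet A) :
    P⟦Y ⁻¹' A | m⟧ =ᵐ[P] fun ω => (κ (X ω)).real A := by
  refine (ae_eq_condExp_of_forall_setIntegral_eq hm
    ((integrable_const (1 : ℝ)).indicator (hY hA))
    (fun s _ _ => (integrable_kernel_real (P := P) (κ := κ) hX hA).integrableOn)
    (fun s hs _ => ?_) ?_).symm
  · rw [integral_indicator (hY hA), setIntegral_const, smul_eq_mul, mul_one,
      measureReal_restrict_apply (hY hA), measureReal_def, h.measure_inter hX hY hs hA]
    exact integral_toReal ((κ.measurable_coe hA).comp hX).aemeasurable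
      (.of_forall fun _ => measure_lt_top _ _)
  · have hXm' : Measurable[m] X := measurable_iff_comap_le.2 hXm
    exact (((κ.measurable_coe hA).comp hXm').ennreal_toReal.stronglyMeasurable).aestronglyMeasurable

lemma HasKernelGiven.of_condExp_ae_eq [IsFiniteMeasure P] {Y : Ω → F}
    {X : Ω → E} {κ : Kernel E F} [IsMarkovKernel κ]
    (hX : Measurable X) (hY : Measurable Y) (hm : m ≤ mΩ)
    (h : ∀ A, MeasurableSet A → P⟦Y ⁻¹' A | m⟧ =ᵐ[P] fun ω => (κ (X ω)).real A) :
    HasKernelGiven m P Y X κ := by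
  intro B hB
  ext A hA
  rw [Measure.map_apply hY hA, Measure.restrict_apply (hY hA),
    Measure.bind_apply hA κ.aemeasurable, lintegral_map (κ.measurable_coe hA) hX]
  have h1 := setIntegral_condExp hm ((integrable_const (1 : ℝ) (μ := P)).indicator (hY hA)) hB
  rw [setIntegral_congr_ae (hm B hB) ((h A hA).mono fun ω hω _ => hω),
    integral_indicator (hY hA), setIntegral_const, smul_eq_mul, mul_one,
    measureReal_restrict_apply (hY hA), measureReal_def] at h1
  have h2 : ∫ ω in B, (κ (X ω)).real A ∂P = (∫⁻ ω in B, κ (X ω) A ∂P).toReal :=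
    integral_toReal ((κ.measurable_coe hA).comp hX).aemeasurable
      (.of_forall fun _ => measure_lt_top _ _)
  rw [h2] at h1
  refine ((ENNReal.toReal_eq_toReal_iff' ?_ (measure_ne_top _ _)).1 h1).symm
  refine ((setLIntegral_mono' (hm B hB) fun ω _ => prob_le_one).trans_lt ?_).ne
  rw [setLIntegral_const, one_mul]
  exact measure_lt_top _ _

lemma HasKernelGiven.of_hasCondDistrib [IsFiniteMeasure P] {Y : Ω → F} {X : Ω → E}
    {κ : Kernel E F} [IsMarkovKernel κ] (hX : Measurable X) (hY : Measurable Y)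
    (h : HasCondDistrib Y X κ P) : HasKernelGiven (mE.comap X) P Y X κ := by
  rintro B ⟨s, hs, rfl⟩
  ext A hA
  have h1 := congrArg (fun ν => ν (s ×ˢ A)) h.map_eq
  rw [Measure.map_apply (hX.prodMk hY) (hs.prod hA), Measure.compProd_apply_prod hs hA,
    setLIntegral_map hs (κ.measurable_coe hA) hX] at h1
  rw [Measure.map_apply hY hA, Measure.restrict_apply (hY hA),
    Measure.bind_apply hA κ.aemeasurable, lintegral_map (κ.measurable_coe hA) hX, ← h1,
    Set.inter_comm]
  rfl

/-- A draw from the kernel `κ (X ·)` that depends on the past `m` through `X` only has the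
conditional law `κ (X ·)` given `m`. -/
lemma HasKernelGiven.of_dependsOnPastThrough [IsFiniteMeasure P] {Y : Ω → F}
    {X : Ω → E} {κ : Kernel E F} [IsMarkovKernel κ]
    (hX : Measurable X) (hY : Measurable Y) (hm : m ≤ mΩ) (h : HasCondDistrib Y X κ P)
    (hpast : DependsOnPastThrough P Y m X) : HasKernelGiven m P Y X κ :=
  -- The hypothesis on the past replaces `m` by `σ(X)`, where the conditional distribution already
  -- identifies the conditional probability.
  of_condExp_ae_eq hX hY hm fun A hA => (hpast A hA).trans
    ((of_hasCondDistrib hX hY h).condExp_ae_eq hX hY le_rfl hX.comap_le hA)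

lemma HasKernelGiven.dependsOnPastThrough [IsFiniteMeasure P] {Y : Ω → F}
    {X : Ω → E} {κ : Kernel E F} [IsMarkovKernel κ]
    (h : HasKernelGiven m P Y X κ) (hX : Measurable X) (hY : Measurable Y)
    (hXm : mE.comap X ≤ m) (hm : m ≤ mΩ) : DependsOnPastThrough P Y m X :=
  fun _ hA => (h.condExp_ae_eq hX hY hXm hm hA).trans
    ((h.mono hXm).condExp_ae_eq hX hY le_rfl hX.comap_le hA).symm

end CondLaw

/-! ### Laplace functionals of Poisson and gamma random measures. -/

section Laplace

/-- Weighting the Poisson masses by `e^{-an}` gives the exponential series at `r e^{-a}`. -/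
lemma integral_exp_neg_poissonMeasure (r : ℝ≥0) (a : ℝ) :
    ∫ n : ℕ, Real.exp (-(a * n)) ∂(poissonMeasure r) =
      Real.exp (-(r * (1 - Real.exp (-a)))) := by
  rw [integral_poissonMeasure]
  have h := (NormedSpace.expSeries_div_hasSum_exp (𝔸 := ℝ) (r * Real.exp (-a))).mul_left
    (Real.exp (-r))
  rw [← Real.exp_eq_exp_ℝ, ← Real.exp_add] at h
  convert! h.tsum_eq using 1
  · congr 1 with n
    rw [mul_pow, ← Real.exp_nat_mul, smul_eq_mul, mul_neg, mul_comm (n : ℝ) a]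
    ring
  · congr 1
    ring

variable {Θ : Type*} [MeasurableSpace Θ]

lemma measurable_integral_measure {f : Θ → ℝ} (hf : Measurable f) (h0 : ∀ θ, 0 ≤ f θ) :
    Measurable fun ν : Measure Θ => ∫ θ, f θ ∂ν := by
  simp_rw [integral_eq_lintegral_of_nonneg_ae (.of_forall h0) hf.aestronglyMeasurable]
  exact (Measure.measurable_lintegral hf.ennreal_ofReal).ennreal_toReal

lemma measurable_exp_neg_integral {f : Θ → ℝ} (hf : Measurable f) (h0 : ∀ θ, 0 ≤ f θ) :
    Measurable fun ν : Measure Θ => Real.exp (-∫ θ, f θ ∂ν) :=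
  (measurable_integral_measure hf h0).neg.exp

lemma norm_exp_neg_integral_le_one {f : Θ → ℝ} (h0 : ∀ θ, 0 ≤ f θ) (ν : Measure Θ) :
    ‖Real.exp (-∫ θ, f θ ∂ν)‖ ≤ 1 := by
  rw [Real.norm_of_nonneg (Real.exp_nonneg _), Real.exp_le_one_iff, neg_nonpos]
  exact integral_nonneg h0

variable [MetricSpace Θ]

lemma IsBMPlus.integrable {f : Θ → ℝ} (hf : IsBMPlus f) {μ : Measure Θ}
    (hμ : LocFinite μ) : Integrable f μ := by
  obtain ⟨C, hC⟩ := hf.bounded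
  have h : IntegrableOn f (Function.support f) μ :=
    Measure.integrableOn_of_bounded (M := C) (hμ _ hf.bounded_support).ne
      hf.measurable.aestronglyMeasurable
      (.of_forall fun θ => by rw [Real.norm_of_nonneg (hf.nonneg θ)]; exact hC θ)
  exact (integrableOn_iff_integrable_of_support_subset subset_rfl).1 h

/-- Every bounded set lies in a ball of integer radius about a fixed point, so countably many
measurable conditions suffice. An empty space offers no centre and is treated apart. -/
lemma measurableSet_locFinite [BorelSpace Θ] :
    MeasurableSet {ν : Measure Θ | LocFinite ν} := by
  rcases isEmpty_or_nonempty Θ with hΘ | ⟨⟨θ⟩⟩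
  · convert! MeasurableSet.univ
    refine Set.eq_univ_of_forall fun ν B _ => ?_
    simp [Set.eq_empty_of_isEmpty B]
  · have h : {ν : Measure Θ | LocFinite ν} = ⋂ n : ℕ, {ν | ν (Metric.ball θ n) < ∞} := by
      ext ν
      simp only [Set.mem_ofPred_eq, Set.mem_iInter]
      refine ⟨fun h n => h _ Metric.isBounded_ball, fun h B hB => ?_⟩
      obtain ⟨r, hr⟩ := hB.subset_ball θ
      obtain ⟨n, hn⟩ := exists_nat_ge r
      exact (measure_mono (hr.trans (Metric.ball_subset_ball hn))).trans_lt (h n)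
    rw [h]
    exact .iInter fun n =>
      Measure.measurable_coe Metric.isOpen_ball.measurableSet measurableSet_Iio

/-- The joint Laplace transform of the numbers of points of a Poisson random measure in finitely
many disjoint sets. -/
lemma IsPoissonLaw.integral_exp_neg_sum {Q : Measure (Measure Θ)} {μ : Measure Θ}
    (hQ : IsPoissonLaw Q μ) {ι : Type*} [Fintype ι] {A : ι → Set Θ}
    (hA : ∀ i, MeasurableSet (A i)) (hd : Pairwise fun i j => Disjoint (A i) (A j))
    (hμ : ∀ i, μ (A i) < ∞) (a : ι → ℝ) :
    ∫ ν, Real.exp (-∑ i, ν.real (A i) * a i) ∂Q =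
      Real.exp (-∑ i, μ.real (A i) * (1 - Real.exp (-a i))) := by
  have := hQ.isProbabilityMeasure
  have hind : iIndepFun (fun (i : ι) (ν : Measure Θ) => ν (A i)) Q := by
    have e := Fintype.equivFin ι
    have h := hQ.indep _ (fun i => A (e.symm i)) (fun i => hA _)
      fun i j hij => hd (e.symm.injective.ne hij)
    simpa using h.precomp e.injective
  have hg : ∀ i, Measurable fun x : ℝ≥0∞ => Real.exp (-(x.toReal * a i)) := fun i =>
    (ENNReal.measurable_toReal.mul_const _).neg.exp
  have hprod := (hind.comp (fun i x => Real.exp (-(x.toReal * a i))) hg)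
    |>.integral_fun_prod_eq_prod_integral
      fun i => ((hg i).comp (Measure.measurable_coe (hA i))).aestronglyMeasurable
  simp_rw [← Finset.sum_neg_distrib, Real.exp_sum]
  refine hprod.trans (Finset.prod_congr rfl fun i _ => ?_)
  calc ∫ ν : Measure Θ, Real.exp (-((ν (A i)).toReal * a i)) ∂Q
      = ∫ x : ℝ≥0∞, Real.exp (-(x.toReal * a i)) ∂(Q.map fun ν : Measure Θ => ν (A i)) :=
        (integral_map (Measure.measurable_coe (hA i)).aemeasurable
          (hg i).aestronglyMeasurable).symm
    _ = ∫ n : ℕ, Real.exp (-(a i * n)) ∂(poissonMeasure (μ (A i)).toNNReal) := by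
        rw [hQ.poisson _ (hA i) (hμ i), integral_map Measurable.of_discrete.aemeasurable
          (hg i).aestronglyMeasurable]
        simp [mul_comm]
    _ = _ := integral_exp_neg_poissonMeasure _ _

lemma IsPoissonLaw.laplaceFunctional_simpleFunc {Q : Measure (Measure Θ)}
    {μ : Measure Θ} (hQ : IsPoissonLaw Q μ) (hμ : LocFinite μ) (s : SimpleFunc Θ ℝ)
    (hs : IsBMPlus s) :
    laplaceFunctional Q s = Real.exp (-∫ θ, (1 - Real.exp (-s θ)) ∂μ) := by
  classical
  -- The value `0` is dropped because its fibre may have infinite mass. The other fibres lie in the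
  -- bounded support, and `φ 0 = 0` makes the omission harmless.
  let I := s.range.filter (· ≠ 0)
  have hsum : ∀ (φ : ℝ → ℝ), φ 0 = 0 → ∀ ν : Measure Θ, LocFinite ν →
      ∫ θ, φ (s θ) ∂ν = ∑ x : I, ν.real (s ⁻¹' {(x : ℝ)}) * φ x := by
    intro φ hφ ν hν
    have hi : Integrable s ν := hs.integrable hν
    have h : (s.map φ).integral ν = ∫ θ, s.map φ θ ∂ν :=
      (s.map φ).integral_eq_integral ((SimpleFunc.integrable_iff_finMeasSupp.1 hi).map hφ
        |> SimpleFunc.integrable_iff_finMeasSupp.2)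
    rw [SimpleFunc.map_integral s φ hi hφ] at h
    simp only [SimpleFunc.coe_map, Function.comp_apply, smul_eq_mul] at h
    rw [← h, Finset.sum_coe_sort I fun x => ν.real (s ⁻¹' {x}) * φ x, Finset.sum_filter]
    refine Finset.sum_congr rfl fun x _ => ?_
    split_ifs with hx
    · rfl
    · rw [not_not.1 hx, hφ, mul_zero]
  have hfin : ∀ i : I, μ (s ⁻¹' {(i : ℝ)}) < ∞ := fun i =>
    hμ _ (hs.bounded_support.subset fun θ hθ => by
      have h1 : s θ = i := hθ
      rw [Function.mem_support, h1]
      exact (Finset.mem_filter.1 i.2).2)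
  have key := hQ.integral_exp_neg_sum (A := fun i : I => s ⁻¹' {(i : ℝ)})
    (fun i => s.measurableSet_fiber _)
    (fun i j hij => Disjoint.preimage _ (Set.disjoint_singleton.2 (Subtype.coe_ne_coe.2 hij)))
    hfin (fun i => i)
  -- `hsum` serves twice: with `φ x = 1 - e^{-x}` for the mean measure, then with the identity for
  -- almost every realisation.
  rw [laplaceFunctional, hsum (fun x => 1 - Real.exp (-x)) (by simp) μ hμ, ← key]
  exact integral_congr_ae (hQ.locFinite.mono fun ν hν => by
    simp only [hsum (fun x => x) rfl ν hν])

lemma IsBMPlus.mono {f g : Θ → ℝ} (hf : IsBMPlus f) (hg : Measurable g) (h0 : ∀ θ, 0 ≤ g θ)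
    (hgf : ∀ θ, g θ ≤ f θ) : IsBMPlus g where
  measurable := hg
  nonneg := h0
  bounded := hf.bounded.imp fun _ hC θ => (hgf θ).trans (hC θ)
  bounded_support := hf.bounded_support.subset fun θ hθ hfθ =>
    hθ (le_antisymm ((hgf θ).trans hfθ.le) (h0 θ))

/-- The Laplace functional of a Poisson random measure. -/
lemma IsPoissonLaw.laplaceFunctional_eq {Q : Measure (Measure Θ)}
    {μ : Measure Θ} (hQ : IsPoissonLaw Q μ) (hμ : LocFinite μ) {f : Θ → ℝ} (hf : IsBMPlus f) :
    laplaceFunctional Q f = Real.exp (-∫ θ, (1 - Real.exp (-f θ)) ∂μ) := by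
  have := hQ.isProbabilityMeasure
  have hfe := hf.measurable.ennreal_ofReal
  -- Simple approximation from below, `0 ≤ s n ≤ f`, keeps each `s n` in `BM₊` and lets `f`
  -- dominate.
  let s : ℕ → SimpleFunc Θ ℝ := fun n =>
    (SimpleFunc.eapprox (fun θ => ENNReal.ofReal (f θ)) n).map ENNReal.toReal
  have hs0 : ∀ n θ, 0 ≤ s n θ := fun n θ => ENNReal.toReal_nonneg
  have hsf : ∀ n θ, s n θ ≤ f θ := fun n θ => by
    refine ENNReal.toReal_le_of_le_ofReal (hf.nonneg θ) ?_
    exact (le_iSup (fun n => SimpleFunc.eapprox (fun θ => ENNReal.ofReal (f θ)) n θ) n).trans_eq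
      (SimpleFunc.iSup_eapprox_apply hfe θ)
  have hlim : ∀ θ, Filter.Tendsto (fun n => s n θ) Filter.atTop (nhds (f θ)) := fun θ => by
    have h := (ENNReal.tendsto_toReal ENNReal.ofReal_ne_top).comp
      (SimpleFunc.tendsto_eapprox hfe θ)
    rwa [ENNReal.toReal_ofReal (hf.nonneg θ)] at h
  have hsB : ∀ n, IsBMPlus (s n) := fun n => hf.mono (s n).measurable (hs0 n) (hsf n)
  have hL : Filter.Tendsto (fun n => laplaceFunctional Q (s n)) Filter.atTop
      (nhds (laplaceFunctional Q f)) := by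
    refine tendsto_integral_of_dominated_convergence (fun _ => 1)
      (fun n => (measurable_exp_neg_integral (s n).measurable (hs0 n)).aestronglyMeasurable)
      (integrable_const _) (fun n => .of_forall (norm_exp_neg_integral_le_one (hs0 n))) ?_
    filter_upwards [hQ.locFinite] with ν hν
    refine (Real.continuous_exp.tendsto _).comp (Filter.Tendsto.neg ?_)
    exact tendsto_integral_of_dominated_convergence f
      (fun n => (s n).measurable.aestronglyMeasurable) (hf.integrable hν)
      (fun n => .of_forall fun θ => by rw [Real.norm_of_nonneg (hs0 n θ)]; exact hsf n θ)
      (.of_forall hlim)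
  have hR : Filter.Tendsto (fun n => Real.exp (-∫ θ, (1 - Real.exp (-s n θ)) ∂μ)) Filter.atTop
      (nhds (Real.exp (-∫ θ, (1 - Real.exp (-f θ)) ∂μ))) := by
    refine (Real.continuous_exp.tendsto _).comp (Filter.Tendsto.neg ?_)
    refine tendsto_integral_of_dominated_convergence f
      (fun n => (measurable_const.sub (s n).measurable.neg.exp).aestronglyMeasurable)
      (hf.integrable hμ) (fun n => .of_forall fun θ => ?_)
      (.of_forall fun θ => ((Real.continuous_exp.tendsto _).comp (hlim θ).neg).const_sub 1)
    rw [Real.norm_of_nonneg (sub_nonneg.2 (Real.exp_le_one_iff.2 (neg_nonpos.2 (hs0 n θ))))]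
    -- The bound `1 - e^{-x} ≤ x` makes `f` a dominating function here too.
    have := Real.add_one_le_exp (-s n θ)
    linarith [hsf n θ]
  exact tendsto_nhds_unique hL
    (hR.congr fun n => (hQ.laplaceFunctional_simpleFunc hμ (s n) (hsB n)).symm)

/-- This makes `log(1 + f/b)` an admissible test function for the Poisson functional: `log(1+x) ≤ x`
bounds it, and `log 1 = 0` keeps its support inside that of `f`. -/
lemma IsBMPlus.log_one_add_div {f : Θ → ℝ} (hf : IsBMPlus f) {b : ℝ} (hb : 0 < b) :
    IsBMPlus fun θ => Real.log (1 + f θ / b) where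
  measurable := (measurable_const.add (hf.measurable.div_const b)).log
  nonneg θ := Real.log_nonneg (by have := div_nonneg (hf.nonneg θ) hb.le; linarith)
  bounded := by
    obtain ⟨C, hC⟩ := hf.bounded
    refine ⟨C / b, fun θ => ?_⟩
    have h1 := div_nonneg (hf.nonneg θ) hb.le
    have h2 := Real.log_le_sub_one_of_pos (x := 1 + f θ / b) (by linarith)
    have h3 := div_le_div_of_nonneg_right (hC θ) hb.le
    linarith
  bounded_support := hf.bounded_support.subset fun θ hθ hfθ => hθ (by simp [hfθ])

/-- A mixture of the gamma laws `GaP(H + N, b)` over a Poisson random measure `N` with mean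
measure `M` is the noncentral gamma law `NcGaP(H, M, b)`. -/
lemma IsPoissonLaw.isNcGammaLaw_comp [BorelSpace Θ] {κ η : Kernel (Measure Θ) (Measure Θ)}
    [IsMarkovKernel κ] [IsMarkovKernel η] {H M : Measure Θ} {x : Measure Θ} {b : ℝ} (hb : 0 < b)
    (hH : LocFinite H) (hM : LocFinite M) (hκ : IsPoissonLaw (κ x) M)
    (hη : ∀ᵐ N ∂(κ x), IsGammaLaw (η N) (H + N) b) :
    IsNcGammaLaw ((η ∘ₖ κ) x) H M b where
  isProbabilityMeasure := inferInstance
  locFinite := Kernel.ae_comp_of_ae_ae measurableSet_locFinite (hη.mono fun _ h => h.locFinite)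
  laplace f hf := by
    have hg := hf.log_one_add_div hb
    have hint : Integrable (fun ν : Measure Θ => Real.exp (-∫ θ, f θ ∂ν)) ((η ∘ₖ κ) x) :=
      .of_bound (measurable_exp_neg_integral hf.measurable hf.nonneg).aestronglyMeasurable 1
        (.of_forall (norm_exp_neg_integral_le_one hf.nonneg))
    have hpos : ∀ θ, 0 < 1 + f θ / b := fun θ => by
      have := div_nonneg (hf.nonneg θ) hb.le
      linarith
    calc laplaceFunctional ((η ∘ₖ κ) x) f
        = ∫ N, laplaceFunctional (η N) f ∂(κ x) := Kernel.integral_comp hint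
      _ = ∫ N, Real.exp (-∫ θ, Real.log (1 + f θ / b) ∂H) *
            Real.exp (-∫ θ, Real.log (1 + f θ / b) ∂N) ∂(κ x) := by
          refine integral_congr_ae ?_
          -- Splitting the integral over `H + N` needs integrability against both measures, hence
          -- local finiteness of almost every `N`.
          filter_upwards [hη, hκ.locFinite] with N hN hNf
          rw [hN.laplace f hf, integral_add_measure (hg.integrable hH) (hg.integrable hNf),
            neg_add, Real.exp_add]
      _ = Real.exp (-∫ θ, Real.log (1 + f θ / b) ∂H) *
            laplaceFunctional (κ x) fun θ => Real.log (1 + f θ / b) := integral_const_mul _ _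
      _ = _ := by
          rw [hκ.laplaceFunctional_eq hM hg, ← Real.exp_add, ← sub_eq_add_neg]
          -- What remains is `1 - exp(-log(1+x)) = x/(1+x)` with `x = f θ / b`.
          congr! 4 with θ
          rw [Real.exp_neg, Real.exp_log (hpos θ)]
          rw [eq_div_iff (hpos θ).ne', sub_mul, inv_mul_cancel₀ (hpos θ).ne']
          ring

end Laplace

lemma HasKernelGiven.map_eq {Ω E F : Type*} {m mΩ : MeasurableSpace Ω} [MeasurableSpace E]
    [MeasurableSpace F] {P : Measure Ω} {Y : Ω → F} {X : Ω → E} {κ : Kernel E F}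
    (h : HasKernelGiven m P Y X κ) : P.map Y = κ ∘ₘ P.map X := by
  simpa using h Set.univ MeasurableSet.univ

lemma LocFinite.smul {Θ : Type*} [MetricSpace Θ] [MeasurableSpace Θ] {μ : Measure Θ}
    (h : LocFinite μ) {r : ℝ≥0∞} (hr : r ≠ ∞) : LocFinite (r • μ) := fun B hB => by
  rw [Measure.smul_apply, smul_eq_mul]
  exact ENNReal.mul_lt_top hr.lt_top (h B hB)

lemma sigmaRange_le {Ω E : Type*} [mΩ : MeasurableSpace Ω] [MeasurableSpace E] {Z : ℕ → Ω → E}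
    {a : ℕ} (hZ : ∀ s, a ≤ s → Measurable (Z s)) (t : ℕ) : sigmaRange Z a t ≤ mΩ :=
  iSup₂_le fun s hs => (hZ s hs.1).comap_le

lemma comap_le_sigmaRange {Ω E : Type*} [mE : MeasurableSpace E] (Z : ℕ → Ω → E)
    {a s t : ℕ} (has : a ≤ s) (hst : s ≤ t) : mE.comap (Z s) ≤ sigmaRange Z a t :=
  le_iSup₂_of_le s ⟨has, hst⟩ le_rfl

lemma sigmaRange_mono {Ω E : Type*} [MeasurableSpace E] (Z : ℕ → Ω → E) (a : ℕ) {s t : ℕ}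
    (hst : s ≤ t) : sigmaRange Z a s ≤ sigmaRange Z a t :=
  biSup_mono fun _ hr => ⟨hr.1, hr.2.trans hst⟩

/-! ### The state-space model and its Markov property. -/

namespace IsStateSpaceModel

variable {Ω Θ : Type*} [MeasurableSpace Ω] [MetricSpace Θ] [MeasurableSpace Θ] [BorelSpace Θ]
  {P : Measure Ω} [IsProbabilityMeasure P] {H : Measure Θ} {β c : ℕ → ℝ}
  {W V : ℕ → Ω → Measure Θ}

/-- It is assumed at time `1`; afterwards the law of `W t` is a mixture of gamma laws, each carried
by locally finite measures. -/
lemma locFinite_W (h : IsStateSpaceModel P H β c W V) {t : ℕ} (ht : 1 ≤ t) :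
    ∀ᵐ ω ∂P, LocFinite (W t ω) := by
  obtain rfl | ⟨t, ht', rfl⟩ : t = 1 ∨ ∃ s, 1 ≤ s ∧ t = s + 1 := by
    rcases ht.eq_or_lt with h1 | h1
    · exact .inl h1.symm
    · exact .inr ⟨t - 1, by lia, by lia⟩
  · exact h.init_locFinite
  · obtain ⟨η, hη, hcond, hlaw⟩ := h.law_W t ht'
    have hW := h.measurable_W (t + 1) ht
    have hk := HasKernelGiven.of_hasCondDistrib (h.measurable_V (t + 1) (by lia)) hW hcond
    refine (ae_map_iff hW.aemeasurable measurableSet_locFinite).1 ?_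
    rw [hk.map_eq]
    exact Measure.ae_comp_of_ae_ae measurableSet_locFinite (hlaw.mono fun _ hN => hN.locFinite)

/-- Given the past `W₁, …, W_t, V₂, …, V_t`, the law of `W_{t+1}` is given by a kernel at `W_t`
whose values are noncentral gamma laws. -/
lemma exists_transition_kernel (h : IsStateSpaceModel P H β c W V) (hH : LocFinite H) {t : ℕ}
    (ht : 1 ≤ t) (hc : 0 < c (t + 1)) :
    ∃ κ : Kernel (Measure Θ) (Measure Θ), IsMarkovKernel κ ∧
      HasKernelGiven (sigmaRange W 1 t ⊔ sigmaRange V 2 t) P (W (t + 1)) (W t) κ ∧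
      ∀ᵐ M ∂(P.map (W t)),
        IsNcGammaLaw (κ M) H (ENNReal.ofReal (β (t + 1)) • M) (c (t + 1))⁻¹ := by
  obtain ⟨κ, hκ, hκcond, hκlaw⟩ := h.law_V t ht
  obtain ⟨η, hη, hηcond, hηlaw⟩ := h.law_W t ht
  have hWt := h.measurable_W t ht
  have hWt1 := h.measurable_W (t + 1) (by lia)
  have hVt1 := h.measurable_V (t + 1) (by lia)
  have hV : HasKernelGiven _ P (V (t + 1)) (W t) κ :=
    .of_dependsOnPastThrough hWt hVt1
      (sup_le (sigmaRange_le h.measurable_W t) (sigmaRange_le h.measurable_V t))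
      hκcond (h.markov_V t ht)
  have hW : HasKernelGiven _ P (W (t + 1)) (V (t + 1)) η :=
    .of_dependsOnPastThrough hVt1 hWt1
      (sup_le (sigmaRange_le h.measurable_W t) (sigmaRange_le h.measurable_V (t + 1)))
      hηcond (h.markov_W t ht)
  refine ⟨η ∘ₖ κ, inferInstance,
    hV.comp hW (sup_le_sup_left (sigmaRange_mono V 2 t.le_succ) _), ?_⟩
  -- The gamma property holds for almost every value of `V (t + 1)`. Writing that law as the mixture
  -- of `κ M` over the law of `W t` yields it for `κ M`-almost every `N`, for almost every `M`.
  rw [hV.map_eq] at hηlaw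
  have hloc := (ae_map_iff hWt.aemeasurable measurableSet_locFinite).2 (h.locFinite_W ht)
  filter_upwards [hκlaw, Measure.ae_ae_of_ae_comp hηlaw, hloc] with M hM hN hMf
  exact hM.isNcGammaLaw_comp (inv_pos.2 hc) hH (hMf.smul ENNReal.ofReal_ne_top) hN

lemma isMARG1 (h : IsStateSpaceModel P H β c W V) (hH : LocFinite H)
    (hβ : ∀ t, 2 ≤ t → 0 < β t) (hc : ∀ t, 2 ≤ t → 0 < c t) : IsMARG1 P H β c W where
  locFinite_H := hH
  pos_β := hβ
  pos_c := hc
  measurable := h.measurable_W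
  locFinite _ ht := h.locFinite_W ht
  markov t ht := by
    obtain ⟨κ, _, hk, _⟩ := h.exists_transition_kernel hH ht (hc _ (by lia))
    -- The kernel identity holds given the joint past of `W` and `V`, hence on the smaller σ-algebra
    -- of the past of `W` alone.
    exact (hk.mono le_sup_left).dependsOnPastThrough (h.measurable_W t ht)
      (h.measurable_W (t + 1) (by lia)) (comap_le_sigmaRange W ht le_rfl)
      (sigmaRange_le h.measurable_W t)
  transition t ht := by
    obtain ⟨κ, hκ, hk, hlaw⟩ := h.exists_transition_kernel hH ht (hc _ (by lia))
    exact ⟨κ, hκ, hk.hasCondDistrib (h.measurable_W t ht) (h.measurable_W (t + 1) (by lia))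
      ((comap_le_sigmaRange W ht le_rfl).trans le_sup_left), hlaw⟩

end IsStateSpaceModel

end MARG

theorem proposition1 {Ω Θ : Type*} [MeasurableSpace Ω] [MetricSpace Θ] [PolishSpace Θ]
    [MeasurableSpace Θ] [BorelSpace Θ] (P : Measure Ω) [IsProbabilityMeasure P]
    (H : Measure Θ) (hH : MARG.LocFinite H)
    (β c : ℕ → ℝ) (hβ : ∀ t, 2 ≤ t → 0 < β t) (hc : ∀ t, 2 ≤ t → 0 < c t)
    (W V : ℕ → Ω → Measure Θ) (hWV : MARG.IsStateSpaceModel P H β c W V) :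
    (∀ t, 1 ≤ t → MARG.HasCondLaw P (W (t + 1)) (W t)
      (fun M Q => MARG.IsNcGammaLaw Q H (ENNReal.ofReal (β (t + 1)) • M) (c (t + 1))⁻¹)) ∧
    MARG.IsMARG1 P H β c W := by
  have h := hWV.isMARG1 hH hβ hc
  exact ⟨h.transition, h⟩
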